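/- Let $(\Omega_d,\rho_d)$, $d=1,2,3,\dots$, be metric spaces whose families of closed balls have VC dimension $O(d)$, and let $\mu_d$ be a Borel probability measure on $\Omega_d$ with $\mu_d(\Omega_d\setminus S_d)=0$ for some separable $S_d\subseteq\Omega_d$. Assume: (1) (normal Lévy family) there are $C,c>0$ such that $\alpha_d(\epsilon)\le Ce^{-c\epsilon^2d}$ for all $d\ge 1$ and $\epsilon>0$, where $\alpha_d(\epsilon)=\sup\{1-\mu_d(A_\epsilon): A\subseteq\Omega_d \text{ Borel},\ \mu_d(A)\ge\frac12\}$ and $A_\epsilon$ is the open $\epsilon$-neighbourhood of $A$; (2) (normalization) there is $c_1>0$ such that for every $d\geq 1$ the distance $\rho_d$ has, with respect to $\mu_d\otimes\mu_d$, a median $M_d>c_1$. Let $X_d=(x_1,\dots,x_{n_d})$ be an i.i.d. sample from $\mu_d$ of size $n_d$, where $d=\omega(\log n_d)$ and $d=n_d^{o(1)}$ as $d\to\infty$, and let $k_d=o(n_d/d)$. Given pivots $p_1,\dots,p_{k_d}\in\Omega_d$, the cost of the range query with centre $q\in\Omega_d$ and radius $r$ is the number of distance computations $$\mathrm{cost}(q,r)=k_d+\#\{j\le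 n_d:\ \sup_{1\le i\le k_d}|\rho_d(q,p_i)-\rho_d(x_j,p_i)|\le r\}.$$ For $\varepsilon>0$ let $E_d(\varepsilon)$ be the event that, for some choice of the $k_d$ pivots in $\Omega_d$ (possibly depending on $X_d$) and some choice of radii $r(q)\ge\min_j\rho_d(q,x_j)$, $q\in\Omega_d$, at least half of the queries cost less than $(1-\varepsilon)n_d$, that is, $$\mu_d\{q\in\Omega_d:\ \mathrm{cost}(q,r(q))<(1-\varepsilon)n_d\}\ge\tfrac12 .$$ (Outer measures are meant where sets need not be measurable.) Then for all $\varepsilon,\eta>0$ there is a $D$ such that $P(E_d(\varepsilon))<\eta$ for all $d\ge D$. Furthermore, for every $\varepsilon>0$ there are $\eta_d\in(0,1)$ such that $P(E_d(\varepsilon))<\eta_d$ for all sufficiently large $d$, the infinite products $\prod_{d\ge D}(1-\eta_d)$ converge, and $$\lim_{D\to\infty}\prod_{d=D}^{\infty}(1-\eta_d)=1 .$$ -/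

import Mathlib

open MeasureTheory Filter Topology Asymptotics

namespace PivotIndex

noncomputable section

/-- The concentration function of a metric space with a Borel probability measure:
`α(0) = 1/2`, and `α(ε) = sup {1 - μ(A_ε) | A Borel, μ(A) ≥ 1/2}` for `ε > 0`, where
`A_ε` is the open `ε`-neighbourhood of `A`. -/
def concentrationFunction {Ω : Type*} [MetricSpace Ω] [MeasurableSpace Ω]
    (μ : Measure Ω) (ε : ℝ) : ℝ :=
  if ε = 0 then 1 / 2
  else sSup {t : ℝ | ∃ A : Set Ω, MeasurableSet A ∧ 1 / 2 ≤ μ.real A ∧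
    t = 1 - μ.real (Metric.thickening ε A)}

/-- `M` is a median of the function `f` with respect to `μ`. -/
def IsMedian {α : Type*} [MeasurableSpace α] (μ : Measure α) (f : α → ℝ) (M : ℝ) : Prop :=
  1 / 2 ≤ μ.real {a | f a ≤ M} ∧ 1 / 2 ≤ μ.real {a | M ≤ f a}

/-- The collection `𝒜` shatters the finite set `s`: every subset of `s` is cut out of `s`
by a member of `𝒜`. -/
def Shatters {α : Type*} (𝒜 : Set (Set α)) (s : Finset α) : Prop :=
  ∀ t ⊆ s, ∃ A ∈ 𝒜, A ∩ (s : Set α) = (t : Set α)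

/-- The VC dimension of a collection of sets: the supremum, possibly infinite, of the
cardinalities of the finite sets that it shatters. -/
def vcDim {α : Type*} (𝒜 : Set (Set α)) : ℕ∞ :=
  ⨆ (s : Finset α) (_ : Shatters 𝒜 s), (s.card : ℕ∞)

/-- The collection of all closed balls of a metric space. -/
def closedBalls (Ω : Type*) [MetricSpace Ω] : Set (Set Ω) :=
  {B | ∃ (x : Ω) (r : ℝ), 0 < r ∧ B = Metric.closedBall x r}

/-- The pivot distance `ρ_k(q, x) = sup_i |ρ(q, p_i) - ρ(x, p_i)|` (it is `0` without pivots). -/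
def pivotDist {Ω : Type*} [MetricSpace Ω] {k : ℕ} (p : Fin k → Ω) (q x : Ω) : ℝ :=
  ⨆ i : Fin k, |dist q (p i) - dist x (p i)|

/-- The distance from `q` to its nearest neighbour in the dataset `X`. -/
def nnDist {Ω : Type*} [MetricSpace Ω] {n : ℕ} (X : Fin n → Ω) (q : Ω) : ℝ :=
  ⨅ j : Fin n, dist q (X j)

open Classical in
/-- The cost, counted in distance computations, of the range query with centre `q` and radius
`r` on the dataset `X` with pivots `p`: the `k` distances from `q` to the pivots, and one
distance for each data point that is not discarded, i.e. not with `ρ_k(q, x) > r`. -/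
def queryCost {Ω : Type*} [MetricSpace Ω] {n k : ℕ} (X : Fin n → Ω) (p : Fin k → Ω)
    (q : Ω) (r : ℝ) : ℕ :=
  k + (Finset.univ.filter fun j : Fin n => ¬ r < pivotDist p q (X j)).card

/-- The datasets of size `n` for which, for some choice of `k` pivots (which may depend on the
dataset) and some choice of query radii, none smaller than the distance from the query centre
to its nearest neighbour in the dataset, at least half of the queries (query centres being
weighted by `μ`) cost less than `(1 - ε) n`. -/
def fastDatasets {Ω : Type*} [MetricSpace Ω] [MeasurableSpace Ω] (μ : Measure Ω)
    (n k : ℕ) (ε : ℝ) : Set (Fin n → Ω) :=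
  {X | ∃ (p : Fin k → Ω) (r : Ω → ℝ), (∀ q, nnDist X q ≤ r q) ∧
    1 / 2 ≤ μ.real {q | (queryCost X p q (r q) : ℝ) < (1 - ε) * n}}

/-- The (outer) probability that an i.i.d. sample of size `n` from `μ` lies in
`fastDatasets μ n k ε`. -/
def fastProb {Ω : Type*} [MetricSpace Ω] [MeasurableSpace Ω] (μ : Measure Ω)
    (n k : ℕ) (ε : ℝ) : ℝ :=
  (Measure.pi fun _ : Fin n => μ).real (fastDatasets μ n k ε)

end

end PivotIndex

/-!
Distances to a fixed point are `1`-Lipschitz, so by concentration the distance to a pivot `p` is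
within `2 τ` of some value `a p` (an approximate median) outside a set of measure exponentially
small in `d`. Balls of radius `4 τ` are exponentially small too: otherwise a slightly larger ball
would carry most of the mass and the median distance would be small (`measureReal_ball_le`). As
`n` and `k` are `exp (o(d))`, most query centres lie within `2 τ` of the shell of radius `a (p i)`
about `p i` for all pivots, and at distance at least `4 τ` from the dataset. Such a query can discard
only data points that are off the shell of some pivot by more than `2 τ`
(`exists_lt_ncard_offShell_of_mem_fastDatasets`), so it remains to show that with high probability
no choice of pivots puts a proportion `ε` of the sample into the set `offShell` of such points.

The pivots may depend on the sample, so a bound uniform over all pivots is needed. The sets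
`offShell` are cut out by `2 k` balls, hence by Sauer-Shelah have at most about `ℓ ^ (2 k O(d))`
traces on `ℓ` points, which is too much for the classical symmetrization with a ghost sample of the
same size. But `offShell` has measure `exp (-2 γ d)` up to subexponential factors, and so it misses
even a ghost sample of size `n m` with `m` about `exp (γ d)` with probability at least `1 / 2`.
Exchanging each data point at random with one of its `m` ghost points, the chance that a fixed trace
with `ε n` points falls inside the sample is at most `(m + 1) ^ (-ε n)`
(`measure_exists_le_ncard_le`). In the exponent, `O(γ d * k d)` traces stand against `γ d * ε n`,
and `k = o(n / d)` makes the gain win. The resulting bound is exponentially small in `d`, hence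
summable, which gives the infinite products.

The events involve a union over all pivots, which is uncountable, and the exchange argument fails
for outer measures of nonmeasurable sets. It is run with strict inequalities, so that the union
consists of open sets of samples; as the measure is carried by a separable set, it is a countable
union up to a null set (`exists_measurableSet_subset_iUnion`).
-/

namespace PivotIndex

/-! ### Symmetrization with a ghost sample -/

/-- For a family of coordinate permutations that puts no point into `G` more than `B` times,
averaging over the family bounds the measure of `G` by `B` over the size of the family. -/
lemma card_mul_measure_pi_le {Ω ι L : Type*} [MeasurableSpace Ω] [Fintype ι] [Fintype L]
    (μ : Measure Ω) [IsProbabilityMeasure μ] (σ : ι → Equiv.Perm L) {G : Set (L → Ω)}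
    (hG : MeasurableSet G) (B : ℕ)
    (hB : ∀ z : L → Ω, {c : ι | z ∘ σ c ∈ G}.ncard ≤ B) :
    (Fintype.card ι : ENNReal) * Measure.pi (fun _ : L => μ) G ≤ B := by
  classical
  set P := Measure.pi (fun _ : L => μ)
  have hmp : ∀ c, MeasurePreserving (fun z : L → Ω => z ∘ σ c) P P := by
    intro c
    have h := measurePreserving_piCongrLeft (fun _ : L => μ) (σ c).symm
    convert h using 1
    ext z l
    have := MeasurableEquiv.piCongrLeft_apply_apply (β := fun _ : L => Ω) (σ c).symm z (σ c l)
    simpa using this.symm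
  have hpre : ∀ c, P G = ∫⁻ z, ((fun z : L → Ω => z ∘ σ c) ⁻¹' G).indicator 1 z ∂P := by
    intro c
    rw [lintegral_indicator_one ((hmp c).measurable hG),
      (hmp c).measure_preimage hG.nullMeasurableSet]
  calc (Fintype.card ι : ENNReal) * P G
      = ∑ c : ι, ∫⁻ z, ((fun z : L → Ω => z ∘ σ c) ⁻¹' G).indicator 1 z ∂P := by
        rw [← Finset.sum_congr rfl fun c _ => hpre c]
        simp
    _ = ∫⁻ z, ∑ c : ι, ((fun z : L → Ω => z ∘ σ c) ⁻¹' G).indicator 1 z ∂P := by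
        rw [lintegral_finsetSum]
        intro c _
        exact measurable_one.indicator ((hmp c).measurable hG)
    _ ≤ ∫⁻ _, (B : ENNReal) ∂P := by
        refine lintegral_mono fun z => ?_
        have : ∑ c : ι, ((fun z : L → Ω => z ∘ σ c) ⁻¹' G).indicator (1 : (L → Ω) → ENNReal) z
            = (({c : ι | z ∘ σ c ∈ G}.ncard : ℕ) : ENNReal) := by
          rw [Set.ncard_eq_toFinset_card', Finset.card_eq_sum_ones]
          simp [Set.indicator_apply]
        rw [this]
        exact Nat.cast_le.2 (hB z)
    _ = B := by simp

/-- In every row `j`, made of the sample point `j` and `m` ghost points, exchange the sample point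
with the point of the row that `c j` names (`none` names the sample point itself). -/
def rowSwap {ι : Type*} {m : ℕ} (c : ι → Option (Fin m)) : ι ⊕ ι × Fin m → ι ⊕ ι × Fin m
  | .inl j => (c j).elim (.inl j) fun i => .inr (j, i)
  | .inr (j, i) => if c j = some i then .inl j else .inr (j, i)

lemma rowSwap_involutive {ι : Type*} {m : ℕ} (c : ι → Option (Fin m)) :
    Function.Involutive (rowSwap c) := by
  rintro (j | ⟨j, i⟩)
  · rcases h : c j with _ | i <;> simp [rowSwap, h]
  · by_cases h : c j = some i <;> simp [rowSwap, h]

/-- If `T` has at least `s` of its points in the sample and none in the ghost sample after the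
row exchange `c`, then `c` is determined on at least `s` rows. -/
lemma ncard_rowSwap_le {n m s : ℕ} (T : Set (Fin n ⊕ Fin n × Fin m)) :
    {c : Fin n → Option (Fin m) | s ≤ {j | rowSwap c (.inl j) ∈ T}.ncard ∧
      ∀ y, rowSwap c (.inr y) ∉ T}.ncard ≤ (m + 1) ^ (n - s) := by
  classical
  set S := {c : Fin n → Option (Fin m) | s ≤ {j | rowSwap c (.inl j) ∈ T}.ncard ∧
      ∀ y, rowSwap c (.inr y) ∉ T}
  rcases S.eq_empty_or_nonempty with h | ⟨c₀, hc₀⟩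
  · simp [h]
  set R : Finset (Fin n) := Finset.univ.filter fun j => rowSwap c₀ (.inl j) ∈ T
  have hR : s ≤ R.card := by
    have := hc₀.1
    rwa [Set.ncard_eq_toFinset_card', Set.toFinset_ofPred] at this
  have hsub : S ⊆ (Fintype.piFinset fun j => if j ∈ R then {c₀ j} else Finset.univ :
      Finset (Fin n → Option (Fin m))) := by
    intro c hc
    simp only [Finset.mem_coe, Fintype.mem_piFinset]
    intro j
    by_cases hj : j ∈ R
    · rw [if_pos hj, Finset.mem_singleton]
      have hj' : rowSwap c₀ (.inl j) ∈ T := (Finset.mem_filter.1 hj).2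
      -- if `c j ≠ c₀ j`, then `c` leaves in the ghost sample the point of `T` that `c₀` brings
      -- into row `j` of the sample
      by_contra hne
      rcases h0 : c₀ j with _ | i₀
      · rcases h1 : c j with _ | i₁
        · exact hne (h1.trans h0.symm)
        · refine hc.2 (j, i₁) ?_
          simpa [rowSwap, h0, h1] using hj'
      · refine hc.2 (j, i₀) ?_
        have : c j ≠ some i₀ := fun h => hne (h.trans h0.symm)
        simpa [rowSwap, h0, this] using hj'
    · simp [hj]
  calc S.ncard ≤ _ := Set.ncard_le_ncard hsub (Finset.finite_toSet _)
    _ = (m + 1) ^ (n - R.card) := by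
      rw [Set.ncard_coe_finset, Fintype.card_piFinset]
      have : ∀ j, (if j ∈ R then {c₀ j} else Finset.univ : Finset (Option (Fin m))).card
          = if j ∈ R then 1 else m + 1 := by
        intro j; split_ifs <;> simp
      rw [Finset.prod_congr rfl fun j _ => this j, Finset.prod_ite]
      have h2 : (Finset.univ.filter fun j => j ∉ R) = Rᶜ := by ext; simp
      simp [h2, Finset.card_compl]
    _ ≤ (m + 1) ^ (n - s) := Nat.pow_le_pow_right (by omega) (by omega)

/-- If each sample in `E` completes to an element of `H` by a ghost sample with probability at
least `1 / 2`, then the (outer) probability of `E` is at most twice the probability of `H`. -/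
lemma measure_pi_le_two_mul {Ω ι κ : Type*} [MeasurableSpace Ω] [Fintype ι] [Fintype κ]
    (μ : Measure Ω) [IsProbabilityMeasure μ] {E : Set (ι → Ω)} {H : Set (ι ⊕ κ → Ω)}
    (hH : MeasurableSet H)
    (hE : ∀ X ∈ E, 1 / 2 ≤ Measure.pi (fun _ : κ => μ) {Y | Sum.elim X Y ∈ H}) :
    Measure.pi (fun _ : ι => μ) E ≤ 2 * Measure.pi (fun _ : ι ⊕ κ => μ) H := by
  have hmp := measurePreserving_sumPiEquivProdPi_symm (fun _ : ι ⊕ κ => μ)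
  set e := (MeasurableEquiv.sumPiEquivProdPi fun _ : ι ⊕ κ => Ω).symm
  have he : ∀ X Y, e (X, Y) = Sum.elim X Y := by
    intro X Y
    ext (l | l) <;> rfl
  have hH' : MeasurableSet (e ⁻¹' H) := e.measurable hH
  rw [← hmp.measure_preimage hH.nullMeasurableSet, Measure.prod_apply hH']
  set P := Measure.pi (fun _ : ι => μ)
  set Q := Measure.pi (fun _ : κ => μ)
  have hm := measurable_measure_prodMk_left (ν := Q) hH'
  have hmarkov := mul_meas_ge_le_lintegral (μ := P) hm (1 / 2)
  have hsub : E ⊆ {X | 1 / 2 ≤ Q (Prod.mk X ⁻¹' (e ⁻¹' H))} := by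
    intro X hX
    simpa [Set.preimage, he] using hE X hX
  calc P E ≤ 2 * (1 / 2 * P E) := by
        rw [← mul_assoc, one_div, ENNReal.mul_inv_cancel (by norm_num) (by norm_num), one_mul]
    _ ≤ 2 * (1 / 2 * P {X | 1 / 2 ≤ Q (Prod.mk X ⁻¹' (e ⁻¹' H))}) := by gcongr
    _ ≤ _ := by gcongr

/-- A union of open measurable sets agrees, on a separable set, with a measurable subset. -/
lemma exists_measurableSet_subset_iUnion {Z I : Type*} [PseudoMetricSpace Z] [MeasurableSpace Z]
    {S : Set Z} (hS : TopologicalSpace.IsSeparable S) (W : I → Set Z) (hW : ∀ i, IsOpen (W i))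
    (hWm : ∀ i, MeasurableSet (W i)) :
    ∃ G ⊆ ⋃ i, W i, MeasurableSet G ∧ (⋃ i, W i) ∩ S ⊆ G := by
  have := hS.secondCountableTopology
  obtain ⟨T, hT, hTU⟩ := TopologicalSpace.isOpen_iUnion_countable
    (fun i => ((↑) : S → Z) ⁻¹' W i) fun i => (hW i).preimage continuous_subtype_val
  refine ⟨⋃ i ∈ T, W i, Set.iUnion₂_subset fun i _ => Set.subset_iUnion W i,
    MeasurableSet.biUnion hT fun i _ => hWm i, ?_⟩
  rintro z ⟨hz, hzS⟩
  have : (⟨z, hzS⟩ : S) ∈ ⋃ i ∈ T, ((↑) : S → Z) ⁻¹' W i := by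
    rw [hTU]
    simpa using hz
  simpa using this

lemma setOf_le_ncard_eq_biUnion {Z J Ω : Type*} [Finite J] (f : J → Z → Ω) (U : Set Ω) (s : ℕ) :
    {z | s ≤ {j | f j z ∈ U}.ncard}
      = ⋃ R ∈ {R : Set J | s ≤ R.ncard}, ⋂ j ∈ R, f j ⁻¹' U := by
  ext z
  simp only [Set.mem_ofPred_eq, Set.mem_iUnion, Set.mem_iInter, Set.mem_preimage, exists_prop]
  constructor
  · intro h
    exact ⟨_, h, fun j hj => hj⟩
  · rintro ⟨R, hR, h⟩
    exact hR.trans (Set.ncard_le_ncard (fun j hj => h j hj) (Set.toFinite _))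

lemma isOpen_le_ncard {Z J Ω : Type*} [TopologicalSpace Z] [TopologicalSpace Ω] [Finite J]
    (f : J → Z → Ω) (hf : ∀ j, Continuous (f j)) {U : Set Ω} (hU : IsOpen U) (s : ℕ) :
    IsOpen {z | s ≤ {j | f j z ∈ U}.ncard} := by
  rw [setOf_le_ncard_eq_biUnion]
  exact isOpen_biUnion fun R _ => (Set.toFinite R).isOpen_biInter fun j _ => hU.preimage (hf j)

lemma measurableSet_le_ncard {Z J Ω : Type*} [MeasurableSpace Z] [MeasurableSpace Ω] [Finite J]
    (f : J → Z → Ω) (hf : ∀ j, Measurable (f j)) {U : Set Ω} (hU : MeasurableSet U) (s : ℕ) :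
    MeasurableSet {z | s ≤ {j | f j z ∈ U}.ncard} := by
  rw [setOf_le_ncard_eq_biUnion]
  exact MeasurableSet.biUnion (Set.toFinite _).countable fun R _ =>
    MeasurableSet.biInter (Set.toFinite R).countable fun j _ => hf j hU

/-- A uniform bound for relative deviations. Let `U i` be open sets, each disjoint from an open
set `V i` of measure at least `1 - π`, and let `U` have at most `Γ` traces on `n (m + 1)` points.
The probability that some `U i` contains `s` points of a sample of size `n` is at most
`2 Γ / (m + 1) ^ s`, as long as `n m π ≤ 1 / 2`. The gain over the usual factor `2 ^ s` comes from
the size `n m` of the ghost sample. -/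
theorem measure_exists_le_ncard_le {Ω I : Type*} [MetricSpace Ω] [MeasurableSpace Ω] [BorelSpace Ω]
    (μ : Measure Ω) [IsProbabilityMeasure μ]
    (hsep : ∃ S : Set Ω, TopologicalSpace.IsSeparable S ∧ μ Sᶜ = 0)
    (U V : I → Set Ω) (hU : ∀ i, IsOpen (U i)) (hV : ∀ i, IsOpen (V i))
    (hUV : ∀ i, Disjoint (U i) (V i)) {n m s Γ : ℕ} {π : ℝ}
    (hπ : ∀ i, μ.real (V i)ᶜ ≤ π) (hnm : (n * m : ℕ) * π ≤ 1 / 2)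
    (hΓ : ∀ z : Fin n ⊕ Fin n × Fin m → Ω, (Set.range fun i => z ⁻¹' U i).ncard ≤ Γ) :
    (Measure.pi fun _ : Fin n => μ).real {X | ∃ i, s ≤ {j | X j ∈ U i}.ncard}
      ≤ 2 * (Γ / (m + 1 : ℝ) ^ s) := by
  classical
  by_cases hs : n < s
  · have : {X : Fin n → Ω | ∃ i, s ≤ {j | X j ∈ U i}.ncard} = ∅ := by
      ext X
      simp only [Set.mem_ofPred_eq, Set.mem_empty_iff_false, iff_false, not_exists, not_le]
      intro i
      refine (Set.ncard_le_card _).trans_lt ?_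
      simpa using hs
    rw [this]
    simp only [measureReal_empty]
    positivity
  push Not at hs
  obtain ⟨S, hS, hSμ⟩ := hsep
  set L := Fin n ⊕ Fin n × Fin m
  set P := Measure.pi fun _ : L => μ
  -- the samples with ghost points for which `U i` catches `s` sample points and no ghost point
  let W : I → Set (L → Ω) := fun i =>
    {z | s ≤ {j | z (.inl j) ∈ U i}.ncard} ∩ ⋂ y, (fun z : L → Ω => z (.inr y)) ⁻¹' V i
  have hcont : ∀ l, Continuous fun z : L → Ω => z l := fun l => continuous_apply l
  have hWo : ∀ i, IsOpen (W i) := fun i =>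
    (isOpen_le_ncard (fun j (z : L → Ω) => z (.inl j)) (fun j => hcont _) (hU i) s).inter
      (isOpen_iInter_of_finite fun y => (hV i).preimage (hcont _))
  have hWm : ∀ i, MeasurableSet (W i) := fun i =>
    (measurableSet_le_ncard (fun j (z : L → Ω) => z (.inl j)) (fun j => measurable_pi_apply _)
      (hU i).measurableSet s).inter
      (MeasurableSet.iInter fun y => measurable_pi_apply _ (hV i).measurableSet)
  have hSL : TopologicalSpace.IsSeparable (Set.univ.pi fun _ : L => S) := by
    refine TopologicalSpace.IsSeparable.univ_pi ?_
    exact fun _ => hS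
  obtain ⟨G, hGW, hGm, hWG⟩ := exists_measurableSet_subset_iUnion hSL W hWo hWm
  have hnull : P (Set.univ.pi fun _ : L => S)ᶜ = 0 := by
    have : ∀ᵐ z ∂P, ∀ l, z l ∈ S := by
      rw [ae_all_iff]
      intro l
      exact (Measure.quasiMeasurePreserving_eval (fun _ : L => μ) l).ae
        (p := fun x => x ∈ S) hSμ
    rw [← compl_mem_ae_iff, compl_compl]
    filter_upwards [this] with z hz l _ using hz l
  -- `G` is a measurable part of `⋃ i, W i`, so the counting below applies to it, and it misses only
  -- a null set of the union, which `H` puts back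
  set H := G ∪ toMeasurable P (Set.univ.pi fun _ : L => S)ᶜ
  have hHm : MeasurableSet H := hGm.union (measurableSet_toMeasurable _ _)
  have hWH : ∀ i, W i ⊆ H := by
    intro i z hz
    by_cases hzS : z ∈ Set.univ.pi fun _ : L => S
    · exact Or.inl (hWG ⟨Set.mem_iUnion.2 ⟨i, hz⟩, hzS⟩)
    · exact Or.inr (subset_toMeasurable _ _ hzS)
  have hPH : P H ≤ P G := by
    refine (measure_union_le _ _).trans ?_
    rw [measure_toMeasurable, hnull, add_zero]
  -- the ghost sample avoids `(V i)ᶜ` with probability at least `1 / 2`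
  have hhalf : ∀ X ∈ {X : Fin n → Ω | ∃ i, s ≤ {j | X j ∈ U i}.ncard},
      1 / 2 ≤ Measure.pi (fun _ : Fin n × Fin m => μ) {Y | Sum.elim X Y ∈ H} := by
    rintro X ⟨i, hi⟩
    set Q := Measure.pi (fun _ : Fin n × Fin m => μ)
    set A : Set (Fin n × Fin m → Ω) := ⋂ y, (fun Y => Y y) ⁻¹' V i
    have hA : MeasurableSet A :=
      MeasurableSet.iInter fun y => measurable_pi_apply _ (hV i).measurableSet
    have hAH : A ⊆ {Y | Sum.elim X Y ∈ H} := by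
      intro Y hY
      refine hWH i ⟨by simpa using hi, ?_⟩
      simpa [A] using hY
    have hAc : Q.real Aᶜ ≤ 1 / 2 := by
      have h1 : Aᶜ = ⋃ y, (fun Y : Fin n × Fin m → Ω => Y y) ⁻¹' (V i)ᶜ := by
        simp [A, Set.compl_iInter]
      have h2 : ∀ y, Q.real ((fun Y : Fin n × Fin m → Ω => Y y) ⁻¹' (V i)ᶜ) ≤ π := by
        intro y
        rw [measureReal_def, (measurePreserving_eval (fun _ : Fin n × Fin m => μ) y).measure_preimage
          (hV i).measurableSet.compl.nullMeasurableSet]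
        exact hπ i
      rw [h1]
      refine (measureReal_iUnion_fintype_le _).trans ?_
      refine (Finset.sum_le_sum fun y _ => h2 y).trans ?_
      simpa using hnm
    have hA2 : 1 / 2 ≤ Q.real A := by
      rw [probReal_compl_eq_one_sub hA] at hAc
      linarith
    refine le_trans ?_ (measure_mono hAH)
    rw [← ENNReal.ofReal_toReal (measure_ne_top Q A), ← measureReal_def]
    calc (1 / 2 : ENNReal) = ENNReal.ofReal (1 / 2) := by
          rw [ENNReal.ofReal_div_of_pos two_pos]; simp
      _ ≤ _ := ENNReal.ofReal_le_ofReal hA2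
  have hsym := measure_pi_le_two_mul μ hHm hhalf
  -- the row exchanges
  have hcount : ∀ z : L → Ω, {c : Fin n → Option (Fin m) |
      z ∘ (rowSwap_involutive c).toPerm ∈ G}.ncard ≤ Γ * (m + 1) ^ (n - s) := by
    intro z
    set 𝒯 := Set.range fun i => z ⁻¹' U i
    have hfin : 𝒯.Finite := Set.toFinite _
    have hsub : {c : Fin n → Option (Fin m) | z ∘ (rowSwap_involutive c).toPerm ∈ G}
        ⊆ ⋃ T ∈ hfin.toFinset, {c : Fin n → Option (Fin m) |
          s ≤ {j | rowSwap c (.inl j) ∈ T}.ncard ∧ ∀ y, rowSwap c (.inr y) ∉ T} := by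
      intro c hc
      obtain ⟨i, hi⟩ := Set.mem_iUnion.1 (hGW hc)
      simp only [Set.mem_iUnion]
      refine ⟨z ⁻¹' U i, hfin.mem_toFinset.2 ⟨i, rfl⟩, hi.1, fun y hy => ?_⟩
      exact Set.disjoint_left.1 (hUV i) hy (Set.mem_iInter.1 hi.2 y)
    refine (Set.ncard_le_ncard hsub (Set.toFinite _)).trans ?_
    refine (Finset.set_ncard_biUnion_le _ _).trans ?_
    refine (Finset.sum_le_card_nsmul _ _ _ fun T _ => ncard_rowSwap_le T).trans ?_
    rw [smul_eq_mul, ← Set.ncard_eq_toFinset_card _ hfin]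
    exact Nat.mul_le_mul_right _ (hΓ z)
  have hG := card_mul_measure_pi_le μ (fun c : Fin n → Option (Fin m) =>
    (rowSwap_involutive c).toPerm) hGm _ hcount
  have hG' : P.real G ≤ Γ / (m + 1 : ℝ) ^ s := by
    have h := ENNReal.toReal_mono (ENNReal.natCast_ne_top _) hG
    simp only [ENNReal.toReal_mul, ENNReal.toReal_natCast, Fintype.card_fun, Fintype.card_option,
      Fintype.card_fin] at h
    rw [le_div_iff₀ (by positivity)]
    have hpow : (m + 1 : ℝ) ^ n = (m + 1) ^ (n - s) * (m + 1) ^ s := by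
      rw [← pow_add, Nat.sub_add_cancel hs]
    push_cast at h
    rw [hpow] at h
    have hpos : (0 : ℝ) < (m + 1 : ℝ) ^ (n - s) := by positivity
    refine le_of_mul_le_mul_left ?_ hpos
    calc _ = (m + 1 : ℝ) ^ (n - s) * (m + 1) ^ s * (P G).toReal := by
          rw [measureReal_def]; ring
      _ ≤ _ := h
      _ = _ := by ring
  have hfinal := hsym.trans (mul_le_mul_right hPH 2)
  have h2 := ENNReal.toReal_mono (ENNReal.mul_ne_top (by norm_num) (measure_ne_top P G)) hfinal
  rw [ENNReal.toReal_mul] at h2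
  refine h2.trans ?_
  rw [ENNReal.toReal_ofNat, ← measureReal_def]
  exact mul_le_mul_of_nonneg_left hG' two_pos.le

/-! ### Traces of sets of bounded VC dimension -/

lemma sum_Iic_choose_le (ℓ D : ℕ) : ∑ i ∈ Finset.Iic D, ℓ.choose i ≤ (ℓ + 1) ^ D := by
  rw [add_pow, ← Nat.range_succ_eq_Iic]
  refine Finset.sum_le_sum fun i hi => ?_
  have hi' : i ≤ D := Nat.lt_succ_iff.1 (Finset.mem_range.1 hi)
  rw [one_pow, mul_one]
  exact (Nat.choose_le_pow ℓ i).trans (Nat.le_mul_of_pos_right _ (Nat.choose_pos hi'))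

/-- The number of traces on finitely many points, by the Sauer-Shelah lemma. -/
lemma ncard_traces_le {α L : Type*} [Fintype L] {𝒜 : Set (Set α)} {D : ℕ}
    (h : vcDim 𝒜 ≤ D) (z : L → α) :
    ((fun A => z ⁻¹' A) '' 𝒜).ncard ≤ (Fintype.card L + 1) ^ D := by
  classical
  set ℬ : Finset (Finset L) := Finset.univ.filter fun T => ∃ A ∈ 𝒜, (T : Set L) = z ⁻¹' A
  have hdim : ℬ.vcDim ≤ D := by
    refine Finset.sup_le fun s hs => ?_
    rw [Finset.mem_shatterer] at hs
    have hinj : Set.InjOn z s := by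
      intro a ha b hb hab
      obtain ⟨T, hT, hTa⟩ := hs.exists_inter_eq_singleton ha
      obtain ⟨A, -, hA⟩ := (Finset.mem_filter.1 hT).2
      have hmem : ∀ l, l ∈ T ↔ z l ∈ A := fun l => by
        rw [← Finset.mem_coe, hA, Set.mem_preimage]
      have haT : a ∈ T := (Finset.mem_inter.1 (hTa ▸ Finset.mem_singleton_self a)).2
      have hbT : b ∈ T := by rwa [hmem, ← hab, ← hmem]
      have hb' : b ∈ s ∩ T := Finset.mem_inter.2 ⟨hb, hbT⟩
      rw [hTa, Finset.mem_singleton] at hb'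
      exact hb'.symm
    have hshat : Shatters 𝒜 (s.image z) := by
      intro t ht
      obtain ⟨T, hT, hTs⟩ := hs (Finset.filter_subset (fun l => z l ∈ t) s)
      obtain ⟨A, hA𝒜, hA⟩ := (Finset.mem_filter.1 hT).2
      have hmem : ∀ l, l ∈ T ↔ z l ∈ A := fun l => by
        rw [← Finset.mem_coe, hA, Set.mem_preimage]
      have hkey : ∀ l ∈ s, z l ∈ A ↔ z l ∈ t := by
        intro l hl
        have := Finset.ext_iff.1 hTs l
        simp only [Finset.mem_inter, Finset.mem_filter, hl, true_and] at this
        rw [← hmem, this]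
      refine ⟨A, hA𝒜, ?_⟩
      ext x
      simp only [Set.mem_inter_iff, Finset.mem_coe]
      constructor
      · rintro ⟨hxA, hx⟩
        obtain ⟨l, hl, rfl⟩ := Finset.mem_image.1 hx
        exact (hkey l hl).1 hxA
      · intro hx
        obtain ⟨l, hl, rfl⟩ := Finset.mem_image.1 (ht hx)
        exact ⟨(hkey l hl).2 hx, ht hx⟩
    have h1 : ((s.image z).card : ℕ∞) ≤ vcDim 𝒜 :=
      le_iSup₂ (f := fun (s : Finset α) (_ : Shatters 𝒜 s) => (s.card : ℕ∞)) _ hshat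
    rw [Finset.card_image_of_injOn hinj] at h1
    exact_mod_cast h1.trans h
  have himg : (fun A => z ⁻¹' A) '' 𝒜 ⊆ (fun T : Finset L => (T : Set L)) '' ℬ := by
    rintro _ ⟨A, hA, rfl⟩
    refine ⟨(z ⁻¹' A).toFinset, ?_, by simp⟩
    simp only [ℬ, Finset.coe_filter, Set.mem_ofPred_eq, Finset.mem_univ, true_and]
    exact ⟨A, hA, by simp⟩
  calc _ ≤ ((fun T : Finset L => (T : Set L)) '' ℬ).ncard :=
        Set.ncard_le_ncard himg (Set.toFinite _)
    _ ≤ (ℬ : Set (Finset L)).ncard := Set.ncard_image_le (Set.toFinite _)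
    _ = ℬ.card := Set.ncard_coe_finset _
    _ ≤ ℬ.shatterer.card := Finset.card_le_card_shatterer _
    _ ≤ _ := Finset.card_shatterer_le_sum_vcDim
    _ ≤ ∑ i ∈ Finset.Iic D, (Fintype.card L).choose i :=
        Finset.sum_le_sum_of_subset (Finset.Iic_subset_Iic.2 hdim)
    _ ≤ _ := sum_Iic_choose_le _ _

section Balls

variable {Ω L : Type*} [MetricSpace Ω] [Finite L]

/-- On finitely many points, an open ball leaves the trace of a slightly smaller closed ball. -/
lemma preimage_dist_lt_mem (z : L → Ω) (p : Ω) (b : ℝ) :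
    z ⁻¹' {x | dist x p < b} ∈ insert ∅ ((fun A => z ⁻¹' A) '' closedBalls Ω) := by
  by_cases hb : 0 < b
  · right
    have hev : ∀ l, ∀ᶠ r in 𝓝[<] b, (dist (z l) p ≤ r ↔ dist (z l) p < b) := by
      intro l
      by_cases hl : dist (z l) p < b
      · filter_upwards [Ioo_mem_nhdsLT hl] with r hr
        exact iff_of_true hr.1.le hl
      · filter_upwards [self_mem_nhdsWithin] with r hr
        exact iff_of_false (fun h => hl (h.trans_lt hr)) hl
    obtain ⟨r, hr, hr0⟩ := ((eventually_all.2 hev).and (Ioo_mem_nhdsLT hb)).exists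
    refine ⟨Metric.closedBall p r, ⟨p, r, hr0.1, rfl⟩, ?_⟩
    ext l
    exact hr l
  · left
    ext l
    simp only [Set.mem_preimage, Set.mem_ofPred_eq, Set.mem_empty_iff_false, iff_false, not_lt]
    exact (not_lt.1 hb).trans dist_nonneg

/-- On finitely many points, `{x | dist x p ≤ b}` leaves the trace of a slightly larger open
ball; this covers the radii `b ≤ 0`, which `closedBalls` leaves out. -/
lemma preimage_dist_le_mem (z : L → Ω) (p : Ω) (b : ℝ) :
    z ⁻¹' {x | dist x p ≤ b} ∈ insert ∅ ((fun A => z ⁻¹' A) '' closedBalls Ω) := by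
  have hev : ∀ l, ∀ᶠ r in 𝓝[>] b, (dist (z l) p < r ↔ dist (z l) p ≤ b) := by
    intro l
    by_cases hl : dist (z l) p ≤ b
    · filter_upwards [self_mem_nhdsWithin] with r hr
      exact iff_of_true (hl.trans_lt hr) hl
    · filter_upwards [Ioo_mem_nhdsGT (not_le.1 hl)] with r hr
      exact iff_of_false (fun h => (h.trans hr.2).false) hl
  obtain ⟨r, hr⟩ := (eventually_all.2 hev).exists
  convert preimage_dist_lt_mem z p r using 1
  ext l
  exact (hr l).symm

end Balls

/-- The points at distance more than `t` from the sphere of radius `a (p i)` about the pivot `p i`,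
for some `i`. -/
def offShell {Ω : Type*} [MetricSpace Ω] {k : ℕ} (a : Ω → ℝ) (t : ℝ) (p : Fin k → Ω) : Set Ω :=
  {x | ∃ i, t < |dist x (p i) - a (p i)|}

/-- The points at distance less than `t` from the sphere of radius `a (p i)` about the pivot `p i`,
for every `i`. -/
def onShell {Ω : Type*} [MetricSpace Ω] {k : ℕ} (a : Ω → ℝ) (t : ℝ) (p : Fin k → Ω) : Set Ω :=
  {x | ∀ i, |dist x (p i) - a (p i)| < t}

/-- A set `offShell a t p` is cut out by two balls per pivot. -/
lemma ncard_traces_offShell_le {Ω L : Type*} [MetricSpace Ω] [Fintype L] {D : ℕ}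
    (h : vcDim (closedBalls Ω) ≤ D) (k : ℕ) (a : Ω → ℝ) (t : ℝ) (z : L → Ω) :
    (Set.range fun p : Fin k → Ω => z ⁻¹' offShell a t p).ncard
      ≤ ((Fintype.card L + 1) ^ D + 1) ^ (2 * k) := by
  classical
  set 𝒯 : Set (Set L) := insert ∅ ((fun A => z ⁻¹' A) '' closedBalls Ω)
  let cut : (Fin k → 𝒯 × 𝒯) → Set L := fun f => {l | ∃ i, l ∉ (f i).1.1 ∨ l ∈ (f i).2.1}
  have hsub : (Set.range fun p : Fin k → Ω => z ⁻¹' offShell a t p) ⊆ Set.range cut := by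
    rintro _ ⟨p, rfl⟩
    refine ⟨fun i => (⟨_, preimage_dist_le_mem z (p i) (a (p i) + t)⟩,
      ⟨_, preimage_dist_lt_mem z (p i) (a (p i) - t)⟩), ?_⟩
    ext l
    simp only [cut, offShell, Set.mem_ofPred_eq, Set.mem_preimage, lt_abs, not_le]
    refine exists_congr fun i => or_congr ?_ ?_ <;> constructor <;> intro _ <;> linarith
  have h𝒯 : 𝒯.ncard ≤ (Fintype.card L + 1) ^ D + 1 :=
    (Set.ncard_insert_le _ _).trans (Nat.add_le_add_right (ncard_traces_le h z) 1)
  calc _ ≤ (Set.range cut).ncard := Set.ncard_le_ncard hsub (Set.toFinite _)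
    _ ≤ (Set.univ : Set (Fin k → 𝒯 × 𝒯)).ncard := by
        rw [← Set.image_univ]
        exact Set.ncard_image_le (Set.toFinite _)
    _ = (𝒯.ncard) ^ (2 * k) := by
        rw [Set.ncard_univ, Nat.card_fun, Nat.card_prod, Nat.card_coe_set_eq, Nat.card_fin,
          pow_mul, sq]
    _ ≤ _ := Nat.pow_le_pow_left h𝒯 _

/-! ### Concentration of distances -/

lemma one_sub_concentrationFunction_le {Ω : Type*} [MetricSpace Ω] [MeasurableSpace Ω]
    (μ : Measure Ω) {τ : ℝ} (hτ : 0 < τ) {A : Set Ω} (hA : MeasurableSet A)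
    (hA2 : 1 / 2 ≤ μ.real A) :
    1 - concentrationFunction μ τ ≤ μ.real (Metric.thickening τ A) := by
  have hbdd : BddAbove {t : ℝ | ∃ A : Set Ω, MeasurableSet A ∧ 1 / 2 ≤ μ.real A ∧
      t = 1 - μ.real (Metric.thickening τ A)} := by
    refine ⟨1, ?_⟩
    rintro t ⟨A, -, -, rfl⟩
    linarith [measureReal_nonneg (μ := μ) (s := Metric.thickening τ A)]
  rw [concentrationFunction, if_neg hτ.ne']
  linarith [le_csSup hbdd ⟨A, hA, hA2, rfl⟩]

section Concentration

variable {Ω : Type*} [MetricSpace Ω] [MeasurableSpace Ω] [BorelSpace Ω]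
  {μ : Measure Ω} [IsProbabilityMeasure μ] {τ β : ℝ}

/-- The distance to `p` concentrates near a value `a`, a median of it up to an error of `τ`. -/
lemma exists_measureReal_abs_dist_sub_le
    (hconc : ∀ A : Set Ω, MeasurableSet A → 1 / 2 ≤ μ.real A →
      1 - β ≤ μ.real (Metric.thickening τ A))
    (hτ : 0 < τ) (p : Ω) :
    ∃ a : ℝ, μ.real {x | |dist x p - a| < 2 * τ}ᶜ ≤ 2 * β := by
  set T : Set ℝ := {s | 1 / 2 ≤ μ.real {x | dist x p ≤ s}}
  have hd : Continuous fun x : Ω => dist x p := by fun_prop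
  have hTne : T.Nonempty := by
    have hlim : Tendsto (fun N : ℕ => μ.real {x | dist x p ≤ N}) atTop (𝓝 (μ.real Set.univ)) := by
      have hmono : Monotone fun N : ℕ => {x : Ω | dist x p ≤ N} := by
        intro i j hij x hx
        exact le_trans (b := (i : ℝ)) hx (by exact_mod_cast hij)
      have hU : (⋃ N : ℕ, {x : Ω | dist x p ≤ N}) = Set.univ := by
        ext x
        simpa using exists_nat_ge (dist x p)
      have := tendsto_measure_iUnion_atTop (μ := μ) hmono
      rw [hU] at this
      exact (ENNReal.tendsto_toReal (measure_ne_top _ _)).comp this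
    rw [probReal_univ] at hlim
    obtain ⟨N, hN⟩ := (hlim.eventually_const_le (by norm_num : (1 / 2 : ℝ) < 1)).exists
    exact ⟨N, hN⟩
  have hTbdd : BddBelow T := by
    refine ⟨0, fun s hs => ?_⟩
    by_contra hneg
    have : {x : Ω | dist x p ≤ s} = ∅ := by
      ext x
      simp only [Set.mem_ofPred_eq, Set.mem_empty_iff_false, iff_false, not_le]
      exact (not_le.1 hneg).trans_le dist_nonneg
    simp only [T, Set.mem_ofPred_eq, this, measureReal_empty] at hs
    norm_num at hs
  -- `s` is so close to `sInf T` that `s` bounds the distance with probability at least `1 / 2`,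
  -- but `s - τ` does not
  obtain ⟨s, hs, hsT⟩ := exists_lt_of_csInf_lt hTne (lt_add_of_pos_right (sInf T) hτ)
  have hs' : s - τ ∉ T := fun h => by linarith [csInf_le hTbdd h]
  have hm1 : MeasurableSet {x : Ω | dist x p ≤ s} := (isClosed_le hd continuous_const).measurableSet
  have hm2 : MeasurableSet {x : Ω | dist x p ≤ s - τ} :=
    (isClosed_le hd continuous_const).measurableSet
  have h1 := hconc _ hm1 hs
  have h2 := hconc _ hm2.compl (by
    rw [probReal_compl_eq_one_sub hm2]
    simp only [T, Set.mem_ofPred_eq, not_le] at hs'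
    linarith)
  refine ⟨s, ?_⟩
  have hsub : {x : Ω | |dist x p - s| < 2 * τ}ᶜ ⊆
      (Metric.thickening τ {x : Ω | dist x p ≤ s})ᶜ ∪
        (Metric.thickening τ {x : Ω | dist x p ≤ s - τ}ᶜ)ᶜ := by
    intro x hx
    by_contra hcon
    simp only [Set.mem_union, Set.mem_compl_iff, not_or, not_not, Metric.mem_thickening_iff,
      Set.mem_ofPred_eq, not_le] at hcon
    obtain ⟨⟨y, hy, hxy⟩, ⟨w, hw, hxw⟩⟩ := hcon
    refine hx ?_
    rw [Set.mem_ofPred_eq, abs_lt]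
    constructor
    · linarith [dist_triangle_left w p x]
    · linarith [dist_triangle x y p]
  refine (measureReal_mono hsub).trans ((measureReal_union_le _ _).trans ?_)
  rw [probReal_compl_eq_one_sub Metric.isOpen_thickening.measurableSet,
    probReal_compl_eq_one_sub Metric.isOpen_thickening.measurableSet]
  linarith

/-- Small balls have small measure: a ball of larger measure would, thickened, carry more than
`3 / 4` of the mass, and then most pairs of points would be closer than the median distance. -/
lemma measureReal_ball_le
    (hconc : ∀ A : Set Ω, MeasurableSet A → 1 / 2 ≤ μ.real A →
      1 - β ≤ μ.real (Metric.thickening τ A))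
    (hβ : β < 1 / 4) {M R : ℝ} (hR : 2 * (R + 2 * τ) ≤ M)
    (hM : 1 / 2 ≤ (μ.prod μ).real {z | M ≤ dist z.1 z.2}) (x : Ω) :
    μ.real (Metric.ball x R) ≤ β := by
  by_contra! hlt
  set A := Metric.ball x R
  have hAm : MeasurableSet A := Metric.isOpen_ball.measurableSet
  have hA' : MeasurableSet (Metric.thickening τ A) := Metric.isOpen_thickening.measurableSet
  have hhalf : 1 / 2 ≤ μ.real (Metric.thickening τ A) := by
    by_contra! hcon
    have h1 := hconc _ hA'.compl (by rw [probReal_compl_eq_one_sub hA']; linarith)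
    have hdisj : Metric.thickening τ (Metric.thickening τ A)ᶜ ⊆ Aᶜ := by
      intro y hy hyA
      obtain ⟨w, hw, hyw⟩ := Metric.mem_thickening_iff.1 hy
      exact hw (Metric.mem_thickening_iff.2 ⟨y, hyA, by rwa [dist_comm]⟩)
    have h2 := measureReal_mono (μ := μ) hdisj
    rw [probReal_compl_eq_one_sub hAm] at h2
    linarith
  set B := Metric.ball x (R + 2 * τ)
  have hB : 3 / 4 < μ.real B := by
    have h1 := hconc _ hA' hhalf
    have hsub : Metric.thickening τ (Metric.thickening τ A) ⊆ B := by
      intro y hy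
      obtain ⟨w, hw, hyw⟩ := Metric.mem_thickening_iff.1 hy
      obtain ⟨v, hv, hwv⟩ := Metric.mem_thickening_iff.1 hw
      have hv' : dist v x < R := hv
      rw [Metric.mem_ball]
      linarith [dist_triangle y w x, dist_triangle w v x]
    linarith [measureReal_mono (μ := μ) hsub]
  have hsub : {z : Ω × Ω | M ≤ dist z.1 z.2} ⊆ (B ×ˢ B)ᶜ := by
    rintro ⟨y, w⟩ hyw ⟨hy, hw⟩
    have hyw' : M ≤ dist y w := hyw
    have hy' : dist y x < R + 2 * τ := hy
    have hw' : dist w x < R + 2 * τ := hw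
    linarith [dist_triangle_right y w x]
  have hBm : MeasurableSet B := Metric.isOpen_ball.measurableSet
  have h1 := measureReal_mono (μ := μ.prod μ) hsub
  rw [probReal_compl_eq_one_sub (hBm.prod hBm), measureReal_prod_prod] at h1
  nlinarith

end Concentration

/-! ### Fast datasets have many points off the shells -/

lemma isOpen_offShell {Ω : Type*} [MetricSpace Ω] {k : ℕ} (a : Ω → ℝ) (t : ℝ) (p : Fin k → Ω) :
    IsOpen (offShell a t p) := by
  have : offShell a t p = ⋃ i, {x | t < |dist x (p i) - a (p i)|} := by
    ext x; simp [offShell]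
  rw [this]
  exact isOpen_iUnion fun i => isOpen_lt (by fun_prop) (by fun_prop)

lemma isOpen_onShell {Ω : Type*} [MetricSpace Ω] {k : ℕ} (a : Ω → ℝ) (t : ℝ) (p : Fin k → Ω) :
    IsOpen (onShell a t p) := by
  have : onShell a t p = ⋂ i, {x | |dist x (p i) - a (p i)| < t} := by
    ext x; simp [onShell]
  rw [this]
  exact isOpen_iInter_of_finite fun i => isOpen_lt (by fun_prop) (by fun_prop)

lemma disjoint_offShell_onShell {Ω : Type*} [MetricSpace Ω] {k : ℕ} (a : Ω → ℝ) (t : ℝ)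
    (p : Fin k → Ω) : Disjoint (offShell a t p) (onShell a t p) := by
  rw [Set.disjoint_left]
  rintro x ⟨i, hi⟩ h
  exact (hi.trans (h i)).false

lemma measureReal_compl_onShell_le {Ω : Type*} [MetricSpace Ω] [MeasurableSpace Ω]
    (μ : Measure Ω) [IsProbabilityMeasure μ] {a : Ω → ℝ} {t π : ℝ}
    (ha : ∀ p, μ.real {x | |dist x p - a p| < t}ᶜ ≤ π) {k : ℕ} (p : Fin k → Ω) :
    μ.real (onShell a t p)ᶜ ≤ k * π := by
  have : (onShell a t p)ᶜ = ⋃ i, {x | |dist x (p i) - a (p i)| < t}ᶜ := by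
    ext x; simp [onShell]
  rw [this]
  refine (measureReal_iUnion_fintype_le _).trans ?_
  refine (Finset.sum_le_sum fun i _ => ha (p i)).trans ?_
  simp

/-- A query centre on all shells and away from the dataset can only discard data points that are
off some shell. -/
lemma mem_offShell_of_lt_pivotDist {Ω : Type*} [MetricSpace Ω] {k : ℕ} {a : Ω → ℝ} {t r : ℝ}
    {p : Fin k → Ω} {q x : Ω} (ht : 0 < t) (hq : q ∈ onShell a t p) (hr : 2 * t ≤ r)
    (hx : r < pivotDist p q x) : x ∈ offShell a t p := by
  rcases isEmpty_or_nonempty (Fin k) with hk | hk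
  · rw [pivotDist, Real.iSup_of_isEmpty] at hx
    linarith
  · obtain ⟨i, hi⟩ := exists_lt_of_lt_ciSup hx
    refine ⟨i, ?_⟩
    have h1 : |dist q (p i) - dist x (p i)|
        ≤ |dist q (p i) - a (p i)| + |dist x (p i) - a (p i)| := by
      rw [abs_sub_comm (dist x (p i))]
      exact abs_sub_le _ _ _
    linarith [hq i]

/-- For a fast dataset some pivots have more than a proportion `ε` of the data points off their
shells: fast queries have measure at least `1 / 2`, so one of them is centred on all shells and away
from the dataset, and what it discards is off the shells. -/
lemma exists_lt_ncard_offShell_of_mem_fastDatasets {Ω : Type*} [MetricSpace Ω] [MeasurableSpace Ω]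
    (μ : Measure Ω) [IsProbabilityMeasure μ] {a : Ω → ℝ} {t β π ε : ℝ} (ht : 0 < t)
    (hball : ∀ x, μ.real (Metric.ball x (2 * t)) ≤ β)
    (ha : ∀ p, μ.real {x | |dist x p - a p| < t}ᶜ ≤ π)
    {n k : ℕ} (hn : 0 < n) (hnk : n * β + k * π < 1 / 2)
    {X : Fin n → Ω} (hX : X ∈ fastDatasets μ n k ε) :
    ∃ p : Fin k → Ω, ε * n < {j | X j ∈ offShell a t p}.ncard := by
  classical
  obtain ⟨p, r, hr, hfast⟩ := hX
  refine ⟨p, ?_⟩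
  have := Fin.pos_iff_nonempty.1 hn
  have hex : ∃ q ∈ {q | (queryCost X p q (r q) : ℝ) < (1 - ε) * n},
      q ∉ (⋃ j, Metric.ball (X j) (2 * t)) ∪ (onShell a t p)ᶜ := by
    by_contra! hcon
    have h1 := measureReal_mono (μ := μ)
      (show {q | (queryCost X p q (r q) : ℝ) < (1 - ε) * n} ⊆ _ from hcon)
    have h2 : μ.real (⋃ j, Metric.ball (X j) (2 * t)) ≤ n * β := by
      refine (measureReal_iUnion_fintype_le _).trans ?_
      refine (Finset.sum_le_sum fun j _ => hball (X j)).trans ?_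
      simp
    linarith [measureReal_union_le (μ := μ) (⋃ j, Metric.ball (X j) (2 * t)) (onShell a t p)ᶜ,
      measureReal_compl_onShell_le μ ha p]
  obtain ⟨q, hq, hqn⟩ := hex
  simp only [Set.mem_union, Set.mem_iUnion, Metric.mem_ball, not_or, not_exists, not_lt,
    Set.mem_compl_iff, not_not] at hqn
  have hrq : 2 * t ≤ r q := (le_ciInf hqn.1).trans (hr q)
  have hsub : ((Finset.univ.filter fun j : Fin n => r q < pivotDist p q (X j)) : Set (Fin n))
      ⊆ {j | X j ∈ offShell a t p} := by
    intro j hj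
    exact mem_offShell_of_lt_pivotDist ht hqn.2 hrq (by simpa using hj)
  have h1 := Set.ncard_le_ncard hsub (Set.toFinite _)
  rw [Set.ncard_coe_finset] at h1
  have h2 := Finset.card_filter_add_card_filter_not (s := (Finset.univ : Finset (Fin n)))
    (fun j => r q < pivotDist p q (X j))
  rw [Finset.card_univ, Fintype.card_fin] at h2
  have h3 : (queryCost X p q (r q) : ℝ) < (1 - ε) * n := hq
  have h4 : queryCost X p q (r q)
      = k + (Finset.univ.filter fun j : Fin n => ¬ r q < pivotDist p q (X j)).card := by
    unfold queryCost
    congr!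
  rw [h4] at h3
  push_cast at h3
  have h1' : ((Finset.univ.filter fun j : Fin n => r q < pivotDist p q (X j)).card : ℝ)
      ≤ ({j | X j ∈ offShell a t p}.ncard : ℝ) := by exact_mod_cast h1
  have h2' : ((Finset.univ.filter fun j : Fin n => r q < pivotDist p q (X j)).card : ℝ)
      + (Finset.univ.filter fun j : Fin n => ¬ r q < pivotDist p q (X j)).card = n := by
    exact_mod_cast h2
  have h5 : (0 : ℝ) ≤ k := Nat.cast_nonneg k
  nlinarith

/-- The bound for a single space: `m` is the number of ghost points per data point, `s` the number
of data points to be discarded. -/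
theorem fastProb_le {Ω : Type*} [MetricSpace Ω] [MeasurableSpace Ω] [BorelSpace Ω]
    (μ : Measure Ω) [IsProbabilityMeasure μ]
    (hsep : ∃ S : Set Ω, TopologicalSpace.IsSeparable S ∧ μ Sᶜ = 0)
    {D : ℕ} (hvc : vcDim (closedBalls Ω) ≤ D) {τ β M ε : ℝ} (hτ : 0 < τ) (hβ : β < 1 / 4)
    (hconc : ∀ A : Set Ω, MeasurableSet A → 1 / 2 ≤ μ.real A →
      1 - β ≤ μ.real (Metric.thickening τ A))
    (hM : 1 / 2 ≤ (μ.prod μ).real {z | M ≤ dist z.1 z.2}) (hτM : 12 * τ ≤ M)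
    {n k m s : ℕ} (hn : 0 < n) (hnk : n * β + k * (2 * β) < 1 / 2)
    (hnm : (n * m : ℕ) * (k * (2 * β)) ≤ 1 / 2) (hs : s ≤ ε * n + 1) :
    fastProb μ n k ε ≤ 2 * (((n * (m + 1) + 1 : ℕ) ^ D + 1) ^ (2 * k) / (m + 1 : ℝ) ^ s) := by
  choose a ha using exists_measureReal_abs_dist_sub_le hconc hτ
  have hball := measureReal_ball_le (R := 2 * (2 * τ)) hconc hβ (by linarith) hM
  have hsub : fastDatasets μ n k ε ⊆
      {X | ∃ p : Fin k → Ω, s ≤ {j | X j ∈ offShell a (2 * τ) p}.ncard} := by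
    intro X hX
    obtain ⟨p, hp⟩ :=
      exists_lt_ncard_offShell_of_mem_fastDatasets μ (by linarith) hball ha hn hnk hX
    refine ⟨p, Nat.lt_succ_iff.1 ?_⟩
    have : (s : ℝ) < ({j | X j ∈ offShell a (2 * τ) p}.ncard : ℝ) + 1 := by linarith
    exact_mod_cast this
  refine (measureReal_mono hsub).trans ?_
  have hcard : Fintype.card (Fin n ⊕ Fin n × Fin m) = n * (m + 1) := by
    simp only [Fintype.card_sum, Fintype.card_prod, Fintype.card_fin]
    ring
  have := measure_exists_le_ncard_le μ hsep (offShell a (2 * τ)) (onShell a (2 * τ))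
    (isOpen_offShell a _) (isOpen_onShell a _) (disjoint_offShell_onShell a _)
    (Γ := ((n * (m + 1) + 1) ^ D + 1) ^ (2 * k)) (s := s)
    (fun p => measureReal_compl_onShell_le μ ha p) hnm
    (fun z => hcard ▸ ncard_traces_offShell_le hvc k a (2 * τ) z)
  push_cast at this ⊢
  exact this

/-! ### Asymptotics -/

/-- The numerical bound: with about `exp (γ d)` ghost points per data point the number of traces
costs `4 γ d k (K d + 1)` in the exponent, and `ε n` discarded points gain `γ d ε n`. -/
lemma pow_div_pow_le_exp {γ ε d : ℝ} {n k m s K D : ℕ} (hγ : 0 < γ) (hd : 1 ≤ d)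
    (hD : (D : ℝ) ≤ K * d) (hm : Real.exp (γ * d) ≤ m + 1) (hn : 0 < n)
    (hx : ((n * (m + 1) + 1 : ℕ) : ℝ) ≤ Real.exp (2 * γ * d))
    (hk : k * d * (K + 1) ≤ ε * n / 8) (hs : ε * n ≤ s) :
    (((n * (m + 1) + 1 : ℕ) : ℝ) ^ D + 1) ^ (2 * k) / (m + 1 : ℝ) ^ s
      ≤ Real.exp (-(ε * γ / 2 * d * n)) := by
  set x : ℝ := ((n * (m + 1) + 1 : ℕ) : ℝ) with hxdef
  have hx2 : 2 ≤ x := by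
    have : 1 ≤ n * (m + 1) := Nat.mul_pos hn (Nat.succ_pos m)
    rw [hxdef]
    exact_mod_cast Nat.succ_le_succ this
  have h1 : x ^ D + 1 ≤ x ^ (D + 1) := by
    have : 1 ≤ x ^ D := one_le_pow₀ (by linarith)
    rw [pow_succ]
    nlinarith
  have h2 : (x ^ D + 1) ^ (2 * k) ≤ Real.exp (ε * γ / 2 * d * n) := by
    calc (x ^ D + 1) ^ (2 * k) ≤ (x ^ (D + 1)) ^ (2 * k) :=
          pow_le_pow_left₀ (by positivity) h1 _
      _ = x ^ ((D + 1) * (2 * k)) := (pow_mul _ _ _).symm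
      _ ≤ Real.exp (2 * γ * d) ^ ((D + 1) * (2 * k)) :=
          pow_le_pow_left₀ (by positivity) hx _
      _ = Real.exp (((D + 1) * (2 * k) : ℕ) * (2 * γ * d)) := (Real.exp_nat_mul _ _).symm
      _ ≤ _ := by
          refine Real.exp_le_exp.2 ?_
          push_cast
          have hk0 : (0 : ℝ) ≤ k := Nat.cast_nonneg k
          have hDk : ((D : ℝ) + 1) * k ≤ ε * n / 8 := by
            refine le_trans ?_ hk
            nlinarith
          have hγd : 0 < γ * d := by positivity
          nlinarith [mul_le_mul_of_nonneg_left hDk hγd.le]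
  have h3 : Real.exp (ε * γ * d * n) ≤ (m + 1 : ℝ) ^ s := by
    calc Real.exp (ε * γ * d * n) ≤ Real.exp (s * (γ * d)) := by
          refine Real.exp_le_exp.2 ?_
          have hγd : 0 < γ * d := by positivity
          nlinarith [mul_le_mul_of_nonneg_right hs hγd.le]
      _ = Real.exp (γ * d) ^ s := Real.exp_nat_mul _ _
      _ ≤ _ := pow_le_pow_left₀ (Real.exp_pos _).le hm _
  rw [div_le_iff₀ (by positivity)]
  calc _ ≤ Real.exp (ε * γ / 2 * d * n) := h2
    _ = Real.exp (-(ε * γ / 2 * d * n)) * Real.exp (ε * γ * d * n) := by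
        rw [← Real.exp_add]; congr 1; ring
    _ ≤ _ := by gcongr

lemma tendsto_mul_exp_neg_mul_nat (C : ℝ) {a : ℝ} (ha : 0 < a) :
    Tendsto (fun d : ℕ => C * Real.exp (-(a * d))) atTop (𝓝 0) := by
  have h : Tendsto (fun d : ℕ => a * (d : ℝ)) atTop atTop :=
    tendsto_natCast_atTop_atTop.const_mul_atTop ha
  simpa using (Real.tendsto_exp_neg_atTop_nhds_zero.comp h).const_mul C

/-- The infinite products of `1 - η` over the tails of a summable sequence tend to `1`. -/
lemma multipliable_and_tendsto_tprod_one_sub {η : ℕ → ℝ} (h0 : ∀ d, 0 ≤ η d) (h1 : ∀ d, η d ≤ 1)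
    (hsum : Summable η) :
    (∀ D : ℕ, Multipliable fun j : ℕ => 1 - η (D + j)) ∧
      Tendsto (fun D : ℕ => ∏' j : ℕ, (1 - η (D + j))) atTop (𝓝 1) := by
  have hs : ∀ D, Summable fun j => η (D + j) := fun D => by
    simpa [add_comm] using (summable_nat_add_iff D).2 hsum
  have hmul : ∀ D : ℕ, Multipliable fun j : ℕ => 1 - η (D + j) := fun D => by
    simpa [sub_eq_add_neg] using Real.multipliable_one_add_of_summable (hs D).neg
  have hlow : ∀ D N : ℕ, 1 - ∑ j ∈ Finset.range N, η (D + j)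
      ≤ ∏ j ∈ Finset.range N, (1 - η (D + j)) := by
    intro D N
    induction N with
    | zero => simp
    | succ N ih =>
      have hle : ∏ j ∈ Finset.range N, (1 - η (D + j)) ≤ 1 :=
        Finset.prod_le_one (fun j _ => by linarith [h1 (D + j)]) fun j _ => by linarith [h0 (D + j)]
      rw [Finset.sum_range_succ, Finset.prod_range_succ]
      nlinarith [h0 (D + N)]
  refine ⟨hmul, ?_⟩
  have htail : Tendsto (fun D : ℕ => 1 - ∑' j, η (D + j)) atTop (𝓝 1) := by
    have := (tendsto_sum_nat_add η).const_sub 1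
    simpa [add_comm] using this
  refine tendsto_of_tendsto_of_tendsto_of_le_of_le htail tendsto_const_nhds (fun D => ?_)
    fun D => ?_
  · exact le_of_tendsto_of_tendsto' ((hs D).hasSum.tendsto_sum_nat.const_sub 1)
      (hmul D).hasProd.tendsto_prod_nat (hlow D)
  · refine le_of_tendsto' (hmul D).hasProd.tendsto_prod_nat fun N => ?_
    exact Finset.prod_le_one (fun j _ => by linarith [h1 (D + j)]) fun j _ => by
      linarith [h0 (D + j)]

/-- The probability of a fast dataset decays exponentially in the dimension. -/
theorem exists_eventually_fastProb_le
    (Ω : ℕ → Type*) [∀ d, MetricSpace (Ω d)] [∀ d, MeasurableSpace (Ω d)]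
    [∀ d, BorelSpace (Ω d)]
    (μ : ∀ d, Measure (Ω d)) [∀ d, IsProbabilityMeasure (μ d)]
    (hsep : ∀ d, ∃ S : Set (Ω d), TopologicalSpace.IsSeparable S ∧ μ d Sᶜ = 0)
    (hvc : ∃ K : ℕ, ∀ᶠ d : ℕ in atTop, vcDim (closedBalls (Ω d)) ≤ ((K * d : ℕ) : ℕ∞))
    (hlevy : ∃ C c : ℝ, 0 < C ∧ 0 < c ∧ ∀ d : ℕ, 1 ≤ d → ∀ ε : ℝ, 0 < ε →
      concentrationFunction (μ d) ε ≤ C * Real.exp (-c * ε ^ 2 * d))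
    (hmed : ∃ c₁ : ℝ, 0 < c₁ ∧ ∀ d : ℕ, 1 ≤ d → ∃ M : ℝ, c₁ < M ∧
      IsMedian ((μ d).prod (μ d)) (fun z => dist z.1 z.2) M)
    (n k : ℕ → ℕ)
    (hn_log : (fun d : ℕ => Real.log (n d)) =o[atTop] fun d : ℕ => (d : ℝ))
    (hn_pos : ∀ᶠ d in atTop, 0 < n d)
    (hk : (fun d : ℕ => (k d : ℝ)) =o[atTop] fun d : ℕ => (n d : ℝ) / d)
    (ε : ℝ) (hε : 0 < ε) :
    ∃ κ : ℝ, 0 < κ ∧ ∀ᶠ d : ℕ in atTop,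
      fastProb (μ d) (n d) (k d) ε ≤ 2 * Real.exp (-(κ * d)) := by
  obtain ⟨K, hK⟩ := hvc
  obtain ⟨C, c, hC, hc, hlevy⟩ := hlevy
  obtain ⟨c₁, hc₁, hmed⟩ := hmed
  -- `τ` is chosen so that balls of radius `6 τ` have diameter at most `c₁`, and `γ` so that
  -- the concentration function at `τ` is at most `C exp (-2 γ d)`
  set τ := c₁ / 12 with hτdef
  have hτ : 0 < τ := by positivity
  set γ := c * τ ^ 2 / 2 with hγdef
  have hγ : 0 < γ := by positivity
  refine ⟨ε * γ / 2, by positivity, ?_⟩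
  set δ := ε / (8 * (K + 1)) with hδdef
  have hδ : 0 < δ := by positivity
  have hCsmall : ∀ᶠ d : ℕ in atTop, C * Real.exp (-(γ / 2 * d)) < 1 / 8 :=
    (tendsto_mul_exp_neg_mul_nat C (half_pos hγ)).eventually_lt_const (by norm_num)
  have h3small : ∀ᶠ d : ℕ in atTop, 3 * Real.exp (-(3 * γ / 4 * d)) < 1 :=
    (tendsto_mul_exp_neg_mul_nat 3 (by positivity)).eventually_lt_const (by norm_num)
  filter_upwards [hK, hCsmall, h3small, hn_log.bound (by positivity : 0 < γ / 4), hn_pos,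
    hk.bound (lt_min hδ one_pos), eventually_ge_atTop 1] with d hKd hCd h3d hlog hn hkd hd
  have hd1 : (1 : ℝ) ≤ d := by exact_mod_cast hd
  have hd0 : (0 : ℝ) < d := by linarith
  have hn1 : (1 : ℝ) ≤ n d := by exact_mod_cast hn
  set β := C * Real.exp (-(2 * γ * d)) with hβdef
  have hβ0 : 0 < β := by positivity
  have hconc : ∀ A : Set (Ω d), MeasurableSet A → 1 / 2 ≤ (μ d).real A →
      1 - β ≤ (μ d).real (Metric.thickening τ A) := by
    intro A hA hA2
    have h := hlevy d hd τ hτ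
    have he : -c * τ ^ 2 * d = -(2 * γ * d) := by rw [hγdef]; ring
    rw [he] at h
    linarith [one_sub_concentrationFunction_le (μ d) hτ hA hA2]
  have hnle : (n d : ℝ) ≤ Real.exp (γ / 4 * d) := by
    rw [Real.norm_of_nonneg (Real.log_nonneg hn1), Real.norm_of_nonneg hd0.le] at hlog
    rw [← Real.log_le_iff_le_exp (by linarith)]
    exact hlog
  rw [Real.norm_of_nonneg (Nat.cast_nonneg _), Real.norm_of_nonneg (by positivity)] at hkd
  have hnd : (0 : ℝ) ≤ n d / d := by positivity
  have hkn : (k d : ℝ) ≤ n d := by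
    refine hkd.trans ((mul_le_mul_of_nonneg_right (min_le_right _ _) hnd).trans ?_)
    rw [one_mul]
    exact div_le_self (by linarith) hd1
  have hkδ : k d * (d : ℝ) * (K + 1) ≤ ε * n d / 8 := by
    have h := hkd.trans (mul_le_mul_of_nonneg_right (min_le_left _ _) hnd)
    calc k d * (d : ℝ) * (K + 1) ≤ δ * (n d / d) * d * (K + 1) := by gcongr
      _ = ε * n d / 8 := by
        rw [hδdef]
        field_simp
  have hk0 : (0 : ℝ) ≤ k d := Nat.cast_nonneg _
  set u := Real.exp (γ / 4 * d) with hu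
  have hu1 : 1 ≤ u := Real.one_le_exp (by positivity)
  -- every exponential in play is a power of `u = exp (γ d / 4)`
  have hu4 : Real.exp (γ * d) = u ^ 4 := by
    rw [hu, ← Real.exp_nat_mul]; congr 1; push_cast; ring
  have hu8 : Real.exp (2 * γ * d) = u ^ 8 := by
    rw [hu, ← Real.exp_nat_mul]; congr 1; push_cast; ring
  have hβu : β * u ^ 8 = C := by
    rw [hβdef, ← hu8, mul_assoc, ← Real.exp_add]
    simp
  have hCu : C < 1 / 8 * u ^ 2 := by
    have : Real.exp (-(γ / 2 * d)) * u ^ 2 = 1 := by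
      rw [hu, ← Real.exp_nat_mul, ← Real.exp_add, ← Real.exp_zero]; congr 1; push_cast; ring
    calc C = C * Real.exp (-(γ / 2 * d)) * u ^ 2 := by rw [mul_assoc, this, mul_one]
      _ < _ := by gcongr
  have h3u : 3 ≤ u ^ 3 := by
    have : Real.exp (-(3 * γ / 4 * d)) * u ^ 3 = 1 := by
      rw [hu, ← Real.exp_nat_mul, ← Real.exp_add, ← Real.exp_zero]; congr 1; push_cast; ring
    calc (3 : ℝ) = 3 * Real.exp (-(3 * γ / 4 * d)) * u ^ 3 := by rw [mul_assoc, this, mul_one]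
      _ ≤ 1 * u ^ 3 := by gcongr
      _ = u ^ 3 := one_mul _
  have hβu6 : β * u ^ 6 < 1 / 8 := by
    have : β * u ^ 6 * u ^ 2 < 1 / 8 * u ^ 2 := by rw [mul_assoc, ← pow_add, hβu]; exact hCu
    exact lt_of_mul_lt_mul_right this (by positivity)
  have hβuj : ∀ j ≤ 6, β * u ^ j < 1 / 8 := fun j hj =>
    (mul_le_mul_of_nonneg_left (pow_le_pow_right₀ hu1 hj) hβ0.le).trans_lt hβu6
  set m := ⌊Real.exp (γ * d)⌋₊ with hm
  have hm_le : (m : ℝ) ≤ u ^ 4 := hu4 ▸ Nat.floor_le (Real.exp_pos _).le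
  have hm_lt : Real.exp (γ * d) ≤ m + 1 := (Nat.lt_floor_add_one _).le
  set s := ⌈ε * n d⌉₊ with hs
  have hs_le : ε * n d ≤ s := Nat.le_ceil _
  have hs_lt : (s : ℝ) ≤ ε * n d + 1 := (Nat.ceil_lt_add_one (by positivity)).le
  obtain ⟨M, hM, -, hMmed⟩ := hmed d hd
  have hbound := fastProb_le (μ d) (hsep d) hKd hτ (β := β) (M := M) (ε := ε)
    (by have := hβuj 0 (by norm_num); rw [pow_zero, mul_one] at this; linarith)
    hconc hMmed (by rw [hτdef]; linarith) (n := n d) (k := k d) (m := m) (s := s) hn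
    (by
      have h1 := hβuj 1 (by norm_num)
      rw [pow_one] at h1
      linarith [mul_le_mul_of_nonneg_right hnle hβ0.le,
        mul_le_mul_of_nonneg_right (hkn.trans hnle) hβ0.le])
    (by
      push_cast
      calc (n d : ℝ) * m * (k d * (2 * β)) ≤ u * u ^ 4 * (u * (2 * β)) := by
            gcongr
            exact hkn.trans hnle
        _ = 2 * (β * u ^ 6) := by ring
        _ ≤ 1 / 2 := by linarith)
    hs_lt
  refine hbound.trans ?_
  have hx : ((n d * (m + 1) + 1 : ℕ) : ℝ) ≤ Real.exp (2 * γ * d) := by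
    rw [hu8]
    push_cast
    calc (n d : ℝ) * (m + 1) + 1 ≤ u * (u ^ 4 + u ^ 4) + u * u ^ 4 := by
          gcongr
          · exact one_le_pow₀ hu1
          · exact one_le_mul_of_one_le_of_one_le hu1 (one_le_pow₀ hu1)
      _ = 3 * u ^ 5 := by ring
      _ ≤ u ^ 3 * u ^ 5 := by gcongr
      _ = u ^ 8 := by ring
  have hnum := pow_div_pow_le_exp (D := K * d) (K := K) hγ hd1 (by push_cast; exact le_rfl)
    hm_lt hn hx hkδ hs_le
  refine mul_le_mul_of_nonneg_left (hnum.trans (Real.exp_le_exp.2 ?_)) two_pos.le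
  exact neg_le_neg (le_mul_of_one_le_right (by positivity) hn1)

end PivotIndex

theorem mainTheorem1
    (Ω : ℕ → Type*) [∀ d, MetricSpace (Ω d)] [∀ d, MeasurableSpace (Ω d)]
    [∀ d, BorelSpace (Ω d)]
    (μ : ∀ d, Measure (Ω d)) [∀ d, IsProbabilityMeasure (μ d)]
    -- each measure is carried by a separable set
    (hsep : ∀ d, ∃ S : Set (Ω d), TopologicalSpace.IsSeparable S ∧ μ d Sᶜ = 0)
    -- the VC dimension of the closed balls is `O(d)`
    (hvc : ∃ K : ℕ, ∀ᶠ d : ℕ in atTop,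
      PivotIndex.vcDim (PivotIndex.closedBalls (Ω d)) ≤ ((K * d : ℕ) : ℕ∞))
    -- normal Lévy family
    (hlevy : ∃ C c : ℝ, 0 < C ∧ 0 < c ∧ ∀ d : ℕ, 1 ≤ d → ∀ ε : ℝ, 0 < ε →
      PivotIndex.concentrationFunction (μ d) ε ≤ C * Real.exp (-c * ε ^ 2 * d))
    -- normalization: the median distance is bounded away from zero
    (hmed : ∃ c₁ : ℝ, 0 < c₁ ∧ ∀ d : ℕ, 1 ≤ d → ∃ M : ℝ, c₁ < M ∧
      PivotIndex.IsMedian ((μ d).prod (μ d)) (fun z => dist z.1 z.2) M)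
    (n k : ℕ → ℕ)
    -- `d = ω(log n_d)`
    (hn_log : (fun d : ℕ => Real.log (n d)) =o[atTop] fun d : ℕ => (d : ℝ))
    -- `d = n_d ^ o(1)`
    (hn_pow : ∃ e : ℕ → ℝ, Tendsto e atTop (𝓝 0) ∧
      ∀ᶠ d : ℕ in atTop, (d : ℝ) = (n d : ℝ) ^ e d)
    -- `k_d = o(n_d / d)`
    (hk : (fun d : ℕ => (k d : ℝ)) =o[atTop] fun d : ℕ => (n d : ℝ) / d)
    (ε : ℝ) (hε : 0 < ε) :
    (∀ η : ℝ, 0 < η → ∃ D : ℕ, ∀ d ≥ D, PivotIndex.fastProb (μ d) (n d) (k d) ε < η) ∧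
    ∃ η : ℕ → ℝ, (∀ d, 0 < η d ∧ η d < 1) ∧
      (∃ D : ℕ, ∀ d ≥ D, PivotIndex.fastProb (μ d) (n d) (k d) ε < η d) ∧
      (∀ D : ℕ, Multipliable fun j : ℕ => 1 - η (D + j)) ∧
      Tendsto (fun D : ℕ => ∏' j : ℕ, (1 - η (D + j))) atTop (𝓝 1) := by
  -- `d = n ^ e` excludes `n = 0` for `d ≥ 2`, since powers of `0` are `0` or `1`
  have hn_pos : ∀ᶠ d in atTop, 0 < n d := by
    obtain ⟨e, -, he⟩ := hn_pow
    filter_upwards [he, eventually_ge_atTop 2] with d hd hd2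
    by_contra! h0
    have h2 : (2 : ℝ) ≤ d := by exact_mod_cast hd2
    rw [Nat.le_zero.1 h0, Nat.cast_zero] at hd
    by_cases h : e d = 0
    · rw [h, Real.rpow_zero] at hd
      linarith
    · rw [Real.zero_rpow h] at hd
      linarith
  obtain ⟨κ, hκ, hfast⟩ := PivotIndex.exists_eventually_fastProb_le Ω μ hsep hvc hlevy hmed n k
    hn_log hn_pos hk ε hε
  have hκ2 : 0 < κ / 2 := half_pos hκ
  set η : ℕ → ℝ := fun d => 1 / 2 * Real.exp (-(κ / 2 * d)) with hη
  have hη0 : ∀ d, 0 < η d := fun d => by positivity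
  have hη1 : ∀ d, η d < 1 := fun d => by
    have : Real.exp (-(κ / 2 * d)) ≤ 1 := Real.exp_le_one_iff.2 (by
      have : 0 ≤ κ / 2 * d := by positivity
      linarith)
    simp only [hη]
    linarith
  have hlim : Tendsto η atTop (𝓝 0) := PivotIndex.tendsto_mul_exp_neg_mul_nat _ hκ2
  have hsum : Summable η := by
    refine Summable.mul_left _ ?_
    have := Real.summable_exp_nat_mul_iff.2 (neg_lt_zero.2 hκ2)
    refine this.congr fun d => ?_
    congr 1
    ring
  have hlt : ∀ᶠ d in atTop, PivotIndex.fastProb (μ d) (n d) (k d) ε < η d := by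
    filter_upwards [hfast, (PivotIndex.tendsto_mul_exp_neg_mul_nat 4 hκ2).eventually_lt_const
      one_pos] with d hd h4
    refine hd.trans_lt ?_
    have hsq : Real.exp (-(κ * d)) = Real.exp (-(κ / 2 * d)) * Real.exp (-(κ / 2 * d)) := by
      rw [← Real.exp_add]; congr 1; ring
    rw [hsq]
    simp only [hη]
    nlinarith [Real.exp_pos (-(κ / 2 * d))]
  refine ⟨fun η' hη' => ?_, η, fun d => ⟨hη0 d, hη1 d⟩, eventually_atTop.1 hlt,
    PivotIndex.multipliable_and_tendsto_tprod_one_sub (fun d => (hη0 d).le) (fun d => (hη1 d).le)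
      hsum⟩
  refine eventually_atTop.1 ?_
  filter_upwards [hlt, hlim.eventually_lt_const hη'] with d h1 h2 using h1.trans h2
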